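/- Let $N\ge 2$ be an integer and let $v>0$. Let $H$ be an $N\times N$ random matrix from one of the following two ensembles, with scale $v$. - GOE: $H$ is real symmetric, its entries $H_{ij}$, $i\le j$, are independent centred Gaussian random variables, and $\operatorname{Var}H_{ii}=2v$, $\operatorname{Var}H_{ij}=v$ for $i<j$; equivalently, $H$ has density proportional to $\exp\left(-\frac{1}{4v}\operatorname{tr}H^2\right)$ on the real symmetric matrices. - GUE: $H$ is complex Hermitian, the random variables $H_{ii}$ ($1\le i\le N$) and $\operatorname{Re}H_{ij}$, $\operatorname{Im}H_{ij}$ ($i<j$) are independent centred Gaussian, and $\operatorname{Var}H_{ii}=v$, $\operatorname{Var}\operatorname{Re}H_{ij}=\operatorname{Var}\operatorname{Im}H_{ij}=v/2$ for $i<j$; equivalently, $H$ has density proportional to $\exp\left(-\frac{1}{2v}\operatorname{tr}H^2\right)$ on the complex Hermitian matrices. Then the largest eigenvalue $\lambda_{\max}$ of $H$ is a (measurable) real random variable that is not infinitely divisible: it is not the case that for every $n\ge1$ there exist independent identically distributed real random variables $X_1,\dots,X_n$ such that $\lambda_{\max}$ has the same distribution as $X_1+\cdots+X_n$. -/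

import Mathlib

open MeasureTheory ProbabilityTheory
open scoped NNReal

/-- A real random variable `X` is infinitely divisible if for every `n ≥ 1` there are `n`
independent identically distributed real random variables (on some probability space) whose sum
has the same distribution as `X`. -/
def IsInfinitelyDivisible {Ω : Type*} [MeasurableSpace Ω] (X : Ω → ℝ) (P : Measure Ω) : Prop :=
  ∀ n : ℕ, 1 ≤ n →
    ∃ (Ω' : Type) (_ : MeasurableSpace Ω') (P' : Measure Ω') (_ : IsProbabilityMeasure P')
      (Y : Fin n → Ω' → ℝ),
      iIndepFun Y P' ∧
      (∀ i j, IdentDistrib (Y i) (Y j) P' P') ∧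
      IdentDistrib X (fun ω' => ∑ i, Y i ω') P P'

/-- The largest (real) eigenvalue of a square real or complex matrix; meaningful for Hermitian
matrices of positive size, whose spectrum is a nonempty finite set of real numbers. -/
noncomputable def largestEigenvalue {n 𝕜 : Type*} [Fintype n] [DecidableEq n] [RCLike 𝕜]
    (A : Matrix n n 𝕜) : ℝ :=
  sSup (spectrum ℝ A)

theorem largestEigenvalue_isGreatest {n 𝕜 : Type*} [Fintype n] [DecidableEq n] [Nonempty n]
    [RCLike 𝕜] {A : Matrix n n 𝕜} (hA : A.IsHermitian) :
    IsGreatest (spectrum ℝ A) (largestEigenvalue A) := by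
  have h : spectrum ℝ A = Set.range hA.eigenvalues := hA.spectrum_real_eq_range_eigenvalues
  unfold largestEigenvalue
  rw [h]
  have hne : (Set.range hA.eigenvalues).Nonempty := Set.range_nonempty _
  have hfin : (Set.range hA.eigenvalues).Finite := Set.finite_range _
  exact ⟨hne.csSup_mem hfin, fun x hx => le_csSup hfin.bddAbove hx⟩

/-- `H` is an `N × N` GOE random matrix with scale `v`: a real symmetric random matrix whose
entries on and above the diagonal are independent centred Gaussian variables with joint density
proportional to `exp (-(1 / (4 * v)) * tr (H ^ 2))`, that is, with variance `2 * v` on the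
diagonal and `v` off the diagonal. -/
structure IsGOE {Ω : Type*} [MeasurableSpace Ω] {N : ℕ} (H : Ω → Matrix (Fin N) (Fin N) ℝ)
    (v : ℝ≥0) (P : Measure Ω) : Prop where
  isSymm : ∀ ω, (H ω).IsSymm
  law_diag : ∀ i, HasLaw (fun ω => H ω i i) (gaussianReal 0 (2 * v)) P
  law_offDiag : ∀ i j, i < j → HasLaw (fun ω => H ω i j) (gaussianReal 0 v) P
  indep : iIndepFun (fun (p : {p : Fin N × Fin N // p.1 ≤ p.2}) ω => H ω p.1.1 p.1.2) P

/-- `H` is an `N × N` GUE random matrix with scale `v`: a complex Hermitian random matrix such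
that the diagonal entries and the real and imaginary parts of the entries above the diagonal are
independent centred Gaussian variables with joint density proportional to
`exp (-(2 / (4 * v)) * tr (H ^ 2))`, that is, with variance `v` on the diagonal and `v / 2` for
each of the real and imaginary parts off the diagonal. -/
structure IsGUE {Ω : Type*} [MeasurableSpace Ω] {N : ℕ} (H : Ω → Matrix (Fin N) (Fin N) ℂ)
    (v : ℝ≥0) (P : Measure Ω) : Prop where
  isHermitian : ∀ ω, (H ω).IsHermitian
  law_diag : ∀ i, HasLaw (fun ω => (H ω i i).re) (gaussianReal 0 v) P
  law_offDiag_re : ∀ i j, i < j → HasLaw (fun ω => (H ω i j).re) (gaussianReal 0 (v / 2)) P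
  law_offDiag_im : ∀ i j, i < j → HasLaw (fun ω => (H ω i j).im) (gaussianReal 0 (v / 2)) P
  /-- The pairs `i ≤ j` index the real parts of the entries on and above the diagonal, the pairs
  `j < i` index the imaginary parts of the entries `(j, i)` above the diagonal. -/
  indep : iIndepFun (fun (p : Fin N × Fin N) ω =>
    if p.1 ≤ p.2 then (H ω p.1 p.2).re else (H ω p.2 p.1).im) P

/-! Infinite divisibility would force the largest eigenvalue to be Gaussian, and its two tails are
incompatible with that. It is dominated by a sum of absolute values of Gaussians, so its moment
generating function is entire with growth `exp (C * (1 + ‖z‖ ^ 2))`. Divisibility makes this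
function zero-free (`IsInfinitelyDivisible.complexMGF_ne_zero`), hence the exponential of a
quadratic `a * t ^ 2 + b * t` (`exists_eq_cexp_quadratic`, a case of Hadamard factorization). Let
`w` be the variance of a diagonal entry. The eigenvalue exceeds one diagonal entry, so `t → ∞` gives
`a ≥ w / 2`. It also exceeds the mean of two independent ones, of variance `w / 2`, so `t → -∞`
gives `a ≤ w / 4`. See `not_isInfinitelyDivisible_of_gaussian_le`. -/

/-! ### Zero-free entire functions of quadratic exponential growth. -/

theorem exists_eq_cexp_of_differentiable {F : ℂ → ℂ} (hF : Differentiable ℂ F) (h0 : F 0 = 1)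
    (hne : ∀ z, F z ≠ 0) :
    ∃ K : ℂ → ℂ, Differentiable ℂ K ∧ K 0 = 0 ∧ ∀ z, F z = Complex.exp (K z) := by
  have hF' : Differentiable ℂ (deriv F) := hF.deriv
  have hquot : Differentiable ℂ (fun z => deriv F z / F z) := hF'.div hF hne
  obtain ⟨K, hK0, hK⟩ := hquot.isExactOn_univ.with_val_at 0 0
  have hKd : Differentiable ℂ K := fun z => (hK z trivial).differentiableAt
  refine ⟨K, hKd, hK0, fun z => ?_⟩
  have hder : ∀ z, HasDerivAt (fun z => F z * Complex.exp (-K z)) 0 z := by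
    intro z
    have h := (hF z).hasDerivAt.mul (hK z trivial).neg.cexp
    refine h.congr_deriv ?_
    have := hne z
    field_simp
    ring
  have hconst := is_const_of_deriv_eq_zero (fun z => (hder z).differentiableAt)
    (fun z => (hder z).deriv) z 0
  simp only [h0, hK0, neg_zero, Complex.exp_zero, mul_one] at hconst
  rw [Complex.exp_neg] at hconst
  exact (mul_inv_eq_one₀ (Complex.exp_ne_zero _)).1 hconst

theorem norm_le_of_re_le_sq {K : ℂ → ℂ} (hK : Differentiable ℂ K) (h0 : K 0 = 0)
    {C : ℝ} (hC : 0 < C) (hre : ∀ z, (K z).re ≤ C * (1 + ‖z‖ ^ 2)) (z : ℂ) :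
    ‖K z‖ ≤ 10 * C * (1 + ‖z‖ ^ 2) := by
  -- Borel–Carathéodory on a radius comparable to `‖z‖` preserves quadratic growth; the `+ 1` keeps
  -- `R - ‖z‖` positive at `z = 0`.
  set R : ℝ := 2 * ‖z‖ + 1 with hR
  have hz := norm_nonneg z
  have hmaps : Set.MapsTo K (Metric.ball 0 R) {w | w.re ≤ C * (1 + R ^ 2)} := by
    intro w hw
    rw [mem_ball_zero_iff] at hw
    refine (hre w).trans ?_
    gcongr
  have h := Complex.borelCaratheodory_zero (by positivity) hK.differentiableOn hmaps
    (by positivity) (mem_ball_zero_iff.2 (by linarith)) h0 (z := z)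
  refine h.trans ?_
  have hpos : 0 < R - ‖z‖ := by linarith
  rw [div_le_iff₀ hpos]
  have : 2 * (1 + R ^ 2) * ‖z‖ ≤ 10 * (1 + ‖z‖ ^ 2) * (R - ‖z‖) := by
    rw [hR]
    nlinarith [pow_nonneg hz 2, pow_nonneg hz 3, sq_nonneg (‖z‖ - 1)]
  nlinarith

/-- Cauchy's estimate on the circle of radius `1 + ‖z‖` about `z` bounds the second derivative,
which is constant by Liouville; integrate twice. -/
theorem exists_eq_quadratic_of_norm_le {K : ℂ → ℂ} (hK : Differentiable ℂ K) (h0 : K 0 = 0)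
    {C : ℝ} (hbound : ∀ z, ‖K z‖ ≤ C * (1 + ‖z‖ ^ 2)) :
    ∃ a b : ℂ, ∀ z, K z = a * z ^ 2 + b * z := by
  have hC : 0 ≤ C := by simpa [h0] using hbound 0
  have hK1 : Differentiable ℂ (deriv K) := hK.deriv
  have hK2 : Differentiable ℂ (deriv (deriv K)) := hK1.deriv
  have hbdd : ∀ z, ‖deriv (deriv K) z‖ ≤ 8 * C := by
    intro z
    have hz := norm_nonneg z
    have h := Complex.norm_iteratedDeriv_le_of_forall_mem_sphere_norm_le (c := z) (f := K) 2
      (R := 1 + ‖z‖) (C := C * (1 + (1 + 2 * ‖z‖) ^ 2)) (by positivity) hK.diffContOnCl ?_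
    · rw [iteratedDeriv_succ, iteratedDeriv_one] at h
      refine h.trans ?_
      rw [div_le_iff₀ (by positivity)]
      norm_num [Nat.factorial]
      nlinarith [mul_nonneg hC hz, mul_nonneg hC (sq_nonneg ‖z‖)]
    · intro w hw
      refine (hbound w).trans ?_
      have : ‖w‖ ≤ 1 + 2 * ‖z‖ := by
        have h1 : ‖w - z‖ = 1 + ‖z‖ := by simpa [dist_eq_norm] using hw
        linarith [norm_le_norm_add_norm_sub' w z]
      gcongr
  have hconst : ∀ z, deriv (deriv K) z = deriv (deriv K) 0 := fun z =>
    hK2.apply_eq_apply_of_bounded (isBounded_iff_forall_norm_le.2 ⟨8 * C, by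
      rintro _ ⟨z, rfl⟩; exact hbdd z⟩) z 0
  set c := deriv (deriv K) 0
  set b := deriv K 0
  have hlin : ∀ z, deriv K z = c * z + b := by
    intro z
    have hd : ∀ z, HasDerivAt (fun z => deriv K z - c * z) 0 z := fun z => by
      have h := (hK1 z).hasDerivAt.sub ((hasDerivAt_id z).const_mul c)
      rw [hconst z] at h
      simpa using! h
    have := is_const_of_deriv_eq_zero (fun z => (hd z).differentiableAt) (fun z => (hd z).deriv) z 0
    simp only [mul_zero, sub_zero] at this
    linear_combination this
  refine ⟨c / 2, b, fun z => ?_⟩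
  have hd : ∀ z, HasDerivAt (fun z => K z - (c / 2 * z ^ 2 + b * z)) 0 z := fun z => by
    have h := (hK z).hasDerivAt.sub
      (((hasDerivAt_pow 2 z).const_mul (c / 2)).add ((hasDerivAt_id z).const_mul b))
    rw [hlin z] at h
    refine h.congr_deriv ?_
    norm_num
    ring
  have := is_const_of_deriv_eq_zero (fun z => (hd z).differentiableAt) (fun z => (hd z).deriv) z 0
  simp only [h0] at this
  linear_combination this

/-- A zero-free entire function of order at most two and finite type, normalized at the origin, is
the exponential of a quadratic polynomial. -/
theorem exists_eq_cexp_quadratic {F : ℂ → ℂ} (hF : Differentiable ℂ F)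
    (h0 : F 0 = 1) (hne : ∀ z, F z ≠ 0) {C : ℝ}
    (hbound : ∀ z, ‖F z‖ ≤ Real.exp (C * (1 + ‖z‖ ^ 2))) :
    ∃ a b : ℂ, ∀ z, F z = Complex.exp (a * z ^ 2 + b * z) := by
  obtain ⟨K, hKd, hK0, hK⟩ := exists_eq_cexp_of_differentiable hF h0 hne
  have hre : ∀ z, (K z).re ≤ (|C| + 1) * (1 + ‖z‖ ^ 2) := by
    intro z
    have h := hbound z
    rw [hK z, Complex.norm_exp, Real.exp_le_exp] at h
    refine h.trans ?_
    gcongr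
    linarith [le_abs_self C]
  obtain ⟨a, b, hab⟩ := exists_eq_quadratic_of_norm_le hKd hK0
    (fun z => norm_le_of_re_le_sq hKd hK0 (by positivity) hre z)
  exact ⟨a, b, fun z => by rw [hK, hab]⟩

/-! ### Moment generating functions of infinitely divisible variables. -/

section
variable {Ω : Type*} [MeasurableSpace Ω] {P : Measure Ω} {X : Ω → ℝ}

theorem differentiable_complexMGF (hint : ∀ t : ℝ, Integrable (fun ω => Real.exp (t * X ω)) P) :
    Differentiable ℂ (complexMGF X P) := by
  have huniv : integrableExpSet X P = Set.univ := Set.eq_univ_of_forall hint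
  intro z
  exact (analyticAt_complexMGF (by simp [huniv])).differentiableAt

/-- The law of an infinitely divisible variable is an `n`-fold convolution power; when the
exponential moments are finite this passes to the complex moment generating functions. -/
theorem IsInfinitelyDivisible.exists_complexMGF_eq_pow [IsProbabilityMeasure P]
    (hX : IsInfinitelyDivisible X P)
    (hint : ∀ t : ℝ, Integrable (fun ω => Real.exp (t * X ω)) P) {n : ℕ} (hn : 1 ≤ n) :
    ∃ G : ℂ → ℂ, Differentiable ℂ G ∧ ∀ z, complexMGF X P z = G z ^ n := by
  obtain ⟨Ω', _, P', _, Y, hindep, hident, hsum⟩ := hX n hn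
  let i₀ : Fin n := ⟨0, hn⟩
  have hmgf : ∀ t, mgf X P t = mgf (Y i₀) P' t ^ n := by
    intro t
    have h1 : mgf X P t = mgf (∑ i, Y i) P' t := by
      have : (∑ i, Y i) = fun ω' => ∑ i, Y i ω' := by ext; simp
      rw [this]
      exact congrFun (mgf_congr_identDistrib hsum) t
    rw [h1, hindep.mgf_sum₀ (fun i => (hident i i).aemeasurable_fst),
      Finset.prod_congr rfl (fun i _ => congrFun (mgf_congr_identDistrib (hident i i₀)) t)]
    simp
  have hY : ∀ t : ℝ, Integrable (fun ω => Real.exp (t * Y i₀ ω)) P' := by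
    intro t
    -- A non-integrable exponential would give `mgf` the default value `0`, contradicting positivity
    -- of the left side of `hmgf`.
    by_contra h
    have hpos := mgf_pos (hint t)
    rw [hmgf t, mgf_undef h, zero_pow (by omega)] at hpos
    exact lt_irrefl _ hpos
  refine ⟨complexMGF (Y i₀) P', differentiable_complexMGF hY, fun z => ?_⟩
  have hA : AnalyticOnNhd ℂ (complexMGF X P) Set.univ :=
    (differentiable_complexMGF hint).differentiableOn.analyticOnNhd isOpen_univ
  have hB : AnalyticOnNhd ℂ (fun z => complexMGF (Y i₀) P' z ^ n) Set.univ :=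
    ((differentiable_complexMGF hY).pow n).differentiableOn.analyticOnNhd isOpen_univ
  -- Identity theorem: the two sides agree on the real axis, which accumulates at `0`.
  refine hA.eqOn_of_preconnected_of_frequently_eq hB isPreconnected_univ
    (z₀ := ((0 : ℝ) : ℂ)) trivial ?_ (Set.mem_univ z)
  have hreal : ∃ᶠ x : ℝ in nhdsWithin 0 {0}ᶜ,
      complexMGF X P x = complexMGF (Y i₀) P' x ^ n := by
    refine .of_forall fun x => ?_
    rw [complexMGF_ofReal, complexMGF_ofReal, hmgf]
    push_cast
    rfl
  refine Filter.Tendsto.frequently ?_ hreal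
  refine tendsto_nhdsWithin_iff.2 ⟨?_, ?_⟩
  · exact (Complex.continuous_ofReal.tendsto 0).mono_left nhdsWithin_le_nhds
  · filter_upwards [self_mem_nhdsWithin] with x hx
    simpa using hx

/-- A zero would have some finite order `k`; but the function is a `(k + 1)`-th power of an entire
function, so the order would be at least `k + 1`. -/
theorem IsInfinitelyDivisible.complexMGF_ne_zero [IsProbabilityMeasure P]
    (hX : IsInfinitelyDivisible X P)
    (hint : ∀ t : ℝ, Integrable (fun ω => Real.exp (t * X ω)) P) (z : ℂ) :
    complexMGF X P z ≠ 0 := by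
  intro hz
  have hd := differentiable_complexMGF hint
  have hA : AnalyticOnNhd ℂ (complexMGF X P) Set.univ :=
    hd.differentiableOn.analyticOnNhd isOpen_univ
  have h0 : complexMGF X P 0 = 1 := by simp [complexMGF]
  have htop : analyticOrderAt (complexMGF X P) z ≠ ⊤ := by
    refine hA.analyticOrderAt_ne_top_of_isPreconnected isPreconnected_univ
      (Set.mem_univ 0) (Set.mem_univ z) ?_
    rw [analyticOrderAt_eq_zero.2 (Or.inr (by simp [h0]))]
    simp
  obtain ⟨k, hk⟩ := ENat.ne_top_iff_exists.1 htop
  obtain ⟨G, hG, hpow⟩ := hX.exists_complexMGF_eq_pow hint (n := k + 1) (by omega)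
  have hGan : AnalyticAt ℂ G z := hG.analyticAt z
  have heq : complexMGF X P = G ^ (k + 1) := funext hpow
  have hGz : G z = 0 := by
    have := hpow z
    rw [hz] at this
    exact pow_eq_zero_iff (by omega) |>.1 this.symm
  have hord : analyticOrderAt G z ≠ 0 := by
    rw [Ne, hGan.analyticOrderAt_eq_zero]
    simpa using hGz
  rw [heq, analyticOrderAt_pow hGan] at hk
  have h1 : (1 : ℕ∞) ≤ analyticOrderAt G z := Order.one_le_iff_ne_zero.2 hord
  have h2 : ((k + 1 : ℕ) : ℕ∞) ≤ (k : ℕ∞) := by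
    rw [hk, nsmul_eq_mul]
    exact le_mul_of_one_le_right' h1
  rw [Nat.cast_le] at h2
  omega

/-- An infinitely divisible variable whose moment generating function has Gaussian growth has the
moment generating function of a (possibly degenerate) normal law. -/
theorem IsInfinitelyDivisible.exists_mgf_eq_exp_quadratic [IsProbabilityMeasure P]
    (hX : IsInfinitelyDivisible X P)
    (hint : ∀ t : ℝ, Integrable (fun ω => Real.exp (t * X ω)) P) {C : ℝ}
    (hbound : ∀ t, mgf X P t ≤ Real.exp (C * (1 + t ^ 2))) :
    ∃ a b : ℝ, ∀ t, mgf X P t = Real.exp (a * t ^ 2 + b * t) := by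
  obtain ⟨a, b, hab⟩ := exists_eq_cexp_quadratic (differentiable_complexMGF hint)
    (by simp [complexMGF]) (hX.complexMGF_ne_zero hint) (C := |C|) (fun z => by
      refine norm_complexMGF_le_mgf.trans ((hbound _).trans (Real.exp_le_exp.2 ?_))
      have h : z.re ^ 2 ≤ ‖z‖ ^ 2 := by
        rw [← sq_abs]
        gcongr
        exact Complex.abs_re_le_norm z
      calc C * (1 + z.re ^ 2) ≤ |C| * (1 + z.re ^ 2) := by gcongr; exact le_abs_self C
        _ ≤ |C| * (1 + ‖z‖ ^ 2) := by gcongr)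
  -- On the real axis the function is positive, so taking norms leaves only the real parts of the
  -- coefficients.
  refine ⟨a.re, b.re, fun t => ?_⟩
  have h := congrArg norm (hab t)
  rw [complexMGF_ofReal, Complex.norm_real, Real.norm_of_nonneg mgf_nonneg, Complex.norm_exp] at h
  rw [h]
  congr 1
  simp [← Complex.ofReal_pow]

/-! ### Domination by Gaussians. -/

/-- Bounding the sum by its largest term leaves only individual exponentials, so no joint law of the
`y i` is needed. -/
theorem exp_mul_le_sum_of_abs_le_sum {ι : Type*} [Fintype ι] [Nonempty ι] {x : ℝ} {y : ι → ℝ}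
    (h : |x| ≤ ∑ i, |y i|) (t : ℝ) :
    Real.exp (t * x) ≤
      ∑ i, (Real.exp (Fintype.card ι * t * y i) + Real.exp (-(Fintype.card ι * t) * y i)) := by
  obtain ⟨j, -, hj⟩ := Finset.exists_max_image Finset.univ (fun i => |y i|) Finset.univ_nonempty
  have h1 : |x| ≤ Fintype.card ι * |y j| := by
    refine h.trans ((Finset.sum_le_card_nsmul _ _ _ (fun i hi => hj i hi)).trans_eq ?_)
    simp
  have h2 : t * x ≤ |Fintype.card ι * t * y j| := by
    calc t * x ≤ |t * x| := le_abs_self _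
      _ = |t| * |x| := abs_mul _ _
      _ ≤ |t| * (Fintype.card ι * |y j|) := by gcongr
      _ = |Fintype.card ι * t * y j| := by
        rw [abs_mul, abs_mul, Nat.abs_cast]
        ring
  calc Real.exp (t * x) ≤ Real.exp |Fintype.card ι * t * y j| := Real.exp_le_exp.2 h2
    _ ≤ Real.exp (Fintype.card ι * t * y j) + Real.exp (-(Fintype.card ι * t) * y j) := by
        rw [neg_mul]
        exact Real.exp_abs_le _
    _ ≤ _ := Finset.single_le_sum
        (f := fun i => Real.exp (Fintype.card ι * t * y i) +
          Real.exp (-(Fintype.card ι * t) * y i))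
        (fun i _ => by positivity) (Finset.mem_univ j)

theorem integrable_exp_mul_of_hasLaw_gaussianReal [IsProbabilityMeasure P] {m : ℝ} {s : ℝ≥0}
    (hX : HasLaw X (gaussianReal m s) P) (t : ℝ) :
    Integrable (fun ω => Real.exp (t * X ω)) P := by
  rw [← mgf_pos_iff, mgf_gaussianReal hX.map_eq]
  exact Real.exp_pos _

section Domination

variable [IsProbabilityMeasure P] {ι : Type*} [Fintype ι] [Nonempty ι] {G : ι → Ω → ℝ} {s : ι → ℝ≥0}

theorem integrable_exp_mul_of_abs_le_sum_gaussian (hX : AEMeasurable X P)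
    (hG : ∀ i, HasLaw (G i) (gaussianReal 0 (s i)) P) (hle : ∀ ω, |X ω| ≤ ∑ i, |G i ω|) (t : ℝ) :
    Integrable (fun ω => Real.exp (t * X ω)) P := by
  refine Integrable.mono' (integrable_finsetSum Finset.univ fun i _ =>
    (integrable_exp_mul_of_hasLaw_gaussianReal (hG i) (Fintype.card ι * t)).add
      (integrable_exp_mul_of_hasLaw_gaussianReal (hG i) (-(Fintype.card ι * t))))
    (hX.const_mul t).exp.aestronglyMeasurable (ae_of_all _ fun ω => ?_)
  rw [Real.norm_of_nonneg (Real.exp_nonneg _)]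
  exact exp_mul_le_sum_of_abs_le_sum (hle ω) t

theorem exists_mgf_le_of_abs_le_sum_gaussian (hX : AEMeasurable X P)
    (hG : ∀ i, HasLaw (G i) (gaussianReal 0 (s i)) P) (hle : ∀ ω, |X ω| ≤ ∑ i, |G i ω|) :
    ∃ C : ℝ, ∀ t, mgf X P t ≤ Real.exp (C * (1 + t ^ 2)) := by
  set M : ℝ := (Fintype.card ι : ℝ)
  set S : ℝ := ∑ i, (s i : ℝ)
  have hS0 : 0 ≤ S := Finset.sum_nonneg fun i _ => (s i).2
  -- The factor `2 * M` counts the exponentials and is absorbed by `exp (2 * M)`; `S` bounds every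
  -- variance.
  refine ⟨2 * M + S * M ^ 2 / 2, fun t => ?_⟩
  have hint := integrable_exp_mul_of_abs_le_sum_gaussian hX hG hle t
  have hI : ∀ i (u : ℝ), Integrable (fun ω => Real.exp (u * G i ω)) P := fun i u =>
    integrable_exp_mul_of_hasLaw_gaussianReal (hG i) u
  have hterm : ∀ i (u : ℝ), u ^ 2 = (M * t) ^ 2 →
      ∫ ω, Real.exp (u * G i ω) ∂P ≤ Real.exp (S * M ^ 2 / 2 * t ^ 2) := by
    intro i u hu
    have h := mgf_gaussianReal (hG i).map_eq u
    rw [mgf] at h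
    rw [h, hu, Real.exp_le_exp]
    have : (s i : ℝ) ≤ S :=
      Finset.single_le_sum (f := fun i => (s i : ℝ)) (fun i _ => (s i).2) (Finset.mem_univ i)
    nlinarith [mul_le_mul_of_nonneg_right this (sq_nonneg (M * t))]
  calc mgf X P t
      ≤ ∫ ω, ∑ i, (Real.exp (M * t * G i ω) + Real.exp (-(M * t) * G i ω)) ∂P :=
        integral_mono hint (integrable_finsetSum _ fun i _ => (hI i _).add (hI i _))
          fun ω => exp_mul_le_sum_of_abs_le_sum (hle ω) t
    _ = ∑ i, (∫ ω, Real.exp (M * t * G i ω) ∂P + ∫ ω, Real.exp (-(M * t) * G i ω) ∂P) := by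
        refine (integral_finsetSum _ fun i _ => (hI i _).add (hI i _)).trans ?_
        exact Finset.sum_congr rfl fun i _ => integral_add (hI i _) (hI i _)
    _ ≤ ∑ _i : ι, (Real.exp (S * M ^ 2 / 2 * t ^ 2) + Real.exp (S * M ^ 2 / 2 * t ^ 2)) := by
        gcongr with i
        · exact hterm i _ rfl
        · exact hterm i _ (by ring)
    _ = 2 * M * Real.exp (S * M ^ 2 / 2 * t ^ 2) := by
        rw [Finset.sum_const, nsmul_eq_mul, Finset.card_univ]
        ring
    _ ≤ Real.exp (2 * M) * Real.exp (S * M ^ 2 / 2 * t ^ 2) := by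
        gcongr
        linarith [Real.add_one_le_exp (2 * M)]
    _ ≤ Real.exp ((2 * M + S * M ^ 2 / 2) * (1 + t ^ 2)) := by
        rw [← Real.exp_add, Real.exp_le_exp]
        have hM0 : 0 ≤ M := Nat.cast_nonneg _
        nlinarith [mul_nonneg hM0 (sq_nonneg t), mul_nonneg hS0 (sq_nonneg M)]

end Domination

/-- A variable between the maximum of two independent copies of a nondegenerate centred Gaussian
and a finite sum of absolute values of Gaussians is not infinitely divisible: it would have to be
normal, but its upper tail forces a variance larger than its lower tail permits. -/
theorem not_isInfinitelyDivisible_of_gaussian_le {ι : Type*} [Fintype ι] [IsProbabilityMeasure P]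
    {w : ℝ≥0} (hw : 0 < w) (hX : AEMeasurable X P) {D₁ D₂ : Ω → ℝ}
    (hD₁ : HasLaw D₁ (gaussianReal 0 w) P) (hD₂ : HasLaw D₂ (gaussianReal 0 w) P)
    (hindep : IndepFun D₁ D₂ P) (hle₁ : ∀ ω, D₁ ω ≤ X ω) (hle₂ : ∀ ω, D₂ ω ≤ X ω)
    {G : ι → Ω → ℝ} {s : ι → ℝ≥0} (hG : ∀ i, HasLaw (G i) (gaussianReal 0 (s i)) P)
    (hle : ∀ ω, X ω ≤ ∑ i, |G i ω|) :
    ¬ IsInfinitelyDivisible X P := by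
  intro hdiv
  -- Adjoining `D₁`, a lower bound for `X`, turns the one-sided domination into one of `|X|`.
  let G' : Option ι → Ω → ℝ := fun o => o.elim D₁ G
  let s' : Option ι → ℝ≥0 := fun o => o.elim w s
  have hG' : ∀ o, HasLaw (G' o) (gaussianReal 0 (s' o)) P := by
    rintro (_ | i)
    exacts [hD₁, hG i]
  have habs : ∀ ω, |X ω| ≤ ∑ o, |G' o ω| := by
    intro ω
    have hsum : ∑ o, |G' o ω| = |D₁ ω| + ∑ i, |G i ω| := Fintype.sum_option _
    have h0 : 0 ≤ ∑ i, |G i ω| := Finset.sum_nonneg fun i _ => abs_nonneg _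
    rw [hsum, abs_le]
    constructor
    · linarith [hle₁ ω, neg_abs_le (D₁ ω)]
    · linarith [hle ω, abs_nonneg (D₁ ω)]
  have hint := integrable_exp_mul_of_abs_le_sum_gaussian hX hG' habs
  obtain ⟨C, hC⟩ := exists_mgf_le_of_abs_le_sum_gaussian hX hG' habs
  obtain ⟨a, b, hab⟩ := hdiv.exists_mgf_eq_exp_quadratic hint hC
  have hD := fun {D : Ω → ℝ} (hD : HasLaw D (gaussianReal 0 w) P) (t : ℝ) =>
    mgf_gaussianReal hD.map_eq t
  have hupper : ∀ t, 0 ≤ t → w * t ^ 2 / 2 ≤ a * t ^ 2 + b * t := by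
    intro t ht
    rw [← Real.exp_le_exp, ← hab]
    have h := hD hD₁ t
    rw [zero_mul, zero_add] at h
    rw [← h]
    refine integral_mono (integrable_exp_mul_of_hasLaw_gaussianReal hD₁ t) (hint t) fun ω => ?_
    exact Real.exp_le_exp.2 (mul_le_mul_of_nonneg_left (hle₁ ω) ht)
  -- From `X ≥ (D₁ + D₂) / 2`, whose variance is `w / 2` by independence.
  have hlower : ∀ t, 0 ≤ t → a * t ^ 2 - b * t ≤ w * t ^ 2 / 4 := by
    intro t ht
    have hadd : mgf (D₁ + D₂) P (-t / 2) = Real.exp (w * t ^ 2 / 4) := by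
      rw [hindep.mgf_add
        (integrable_exp_mul_of_hasLaw_gaussianReal hD₁ _).aestronglyMeasurable
        (integrable_exp_mul_of_hasLaw_gaussianReal hD₂ _).aestronglyMeasurable,
        hD hD₁, hD hD₂, ← Real.exp_add]
      congr 1
      ring
    have hXt : mgf X P (-t) = Real.exp (a * t ^ 2 - b * t) := by
      rw [hab]
      congr 1
      ring
    rw [← Real.exp_le_exp, ← hXt, ← hadd]
    refine integral_mono (hint (-t)) (hindep.integrable_exp_mul_add
      (integrable_exp_mul_of_hasLaw_gaussianReal hD₁ _)
      (integrable_exp_mul_of_hasLaw_gaussianReal hD₂ _)) fun ω => ?_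
    refine Real.exp_le_exp.2 ?_
    simp only [Pi.add_apply]
    nlinarith [mul_le_mul_of_nonneg_left (hle₁ ω) ht, mul_le_mul_of_nonneg_left (hle₂ ω) ht]
  have hw' : (0 : ℝ) < w := hw
  -- Eliminating `a` from the two bounds gives `w * t ≤ 8 * b`, which this `t` violates.
  set t : ℝ := 8 * |b| / w + 1 with ht
  have ht0 : 0 < t := by positivity
  have h1 := hupper t ht0.le
  have h2 := hlower t ht0.le
  have h3 : w * t = 8 * |b| + w := by
    rw [ht]
    field_simp
  have h4 : w * t * t ≤ 8 * b * t := by nlinarith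
  have h5 : w * t ≤ 8 * b := le_of_mul_le_mul_right h4 ht0
  linarith [le_abs_self b]
end

/-! ### Variational characterization and measurability of the largest eigenvalue. -/

section LargestEigenvalue

open Matrix RCLike
open scoped ComplexOrder

variable {n 𝕜 : Type*} [Fintype n] [RCLike 𝕜]

theorem re_star_dotProduct_self (x : n → 𝕜) : re (star x ⬝ᵥ x) = ∑ i, ‖x i‖ ^ 2 := by
  simp only [dotProduct, map_sum, Pi.star_apply]
  refine Finset.sum_congr rfl fun i _ => ?_
  rw [RCLike.star_def, RCLike.conj_mul]
  rw [← RCLike.ofReal_pow, RCLike.ofReal_re]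

variable [DecidableEq n] [Nonempty n] {A : Matrix n n 𝕜}

theorem Matrix.IsHermitian.re_dotProduct_mulVec_le_largestEigenvalue (hA : A.IsHermitian)
    (x : n → 𝕜) :
    re (star x ⬝ᵥ A *ᵥ x) ≤ largestEigenvalue A * re (star x ⬝ᵥ x) := by
  set l := largestEigenvalue A
  have hsub : (algebraMap ℝ (Matrix n n 𝕜) l - A).IsHermitian :=
    (IsSelfAdjoint.algebraMap _ (IsSelfAdjoint.all l)).sub hA
  -- The spectrum of `l - A` consists of the `l - m` with `m ≤ l` in the spectrum of `A`.
  have hB : (algebraMap ℝ (Matrix n n 𝕜) l - A).PosSemidef := by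
    rw [hsub.posSemidef_iff_eigenvalues_nonneg]
    intro i
    have hi : hsub.eigenvalues i ∈ spectrum ℝ (algebraMap ℝ (Matrix n n 𝕜) l - A) := by
      rw [hsub.spectrum_real_eq_range_eigenvalues]
      exact ⟨i, rfl⟩
    rw [← spectrum.singleton_sub_eq] at hi
    obtain ⟨_, rfl, m, hm, hml⟩ := hi
    have : m ≤ l := (largestEigenvalue_isGreatest hA).2 hm
    simp only at hml
    rw [Pi.zero_apply, ← hml]
    linarith
  have h := hB.re_dotProduct_nonneg x
  rw [sub_mulVec, dotProduct_sub, map_sub, Algebra.algebraMap_eq_smul_one, smul_mulVec,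
    one_mulVec, dotProduct_smul, RCLike.smul_re] at h
  linarith

theorem Matrix.IsHermitian.exists_re_dotProduct_mulVec_eq_largestEigenvalue (hA : A.IsHermitian) :
    ∃ x : n → 𝕜, re (star x ⬝ᵥ x) = 1 ∧ re (star x ⬝ᵥ A *ᵥ x) = largestEigenvalue A := by
  have h := (largestEigenvalue_isGreatest hA).1
  rw [hA.spectrum_real_eq_range_eigenvalues] at h
  obtain ⟨i, hi⟩ := h
  have h1 : re (star (hA.eigenvectorBasis i).ofLp ⬝ᵥ (hA.eigenvectorBasis i).ofLp) = 1 := by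
    rw [re_star_dotProduct_self, ← EuclideanSpace.norm_sq_eq,
      hA.eigenvectorBasis.orthonormal.1 i, one_pow]
  refine ⟨(hA.eigenvectorBasis i).ofLp, h1, ?_⟩
  rw [hA.mulVec_eigenvectorBasis, dotProduct_smul, RCLike.smul_re, h1, mul_one, hi]

theorem Matrix.IsHermitian.re_apply_self_le_largestEigenvalue (hA : A.IsHermitian) (i : n) :
    re (A i i) ≤ largestEigenvalue A := by
  have h := hA.re_dotProduct_mulVec_le_largestEigenvalue (Pi.single i 1)
  rw [re_star_dotProduct_self] at h
  simpa [Pi.single_apply, apply_ite, ← Pi.single_star] using h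

theorem Matrix.IsHermitian.largestEigenvalue_le_sum_norm (hA : A.IsHermitian) :
    largestEigenvalue A ≤ ∑ i, ∑ j, ‖A i j‖ := by
  obtain ⟨x, hx, hl⟩ := hA.exists_re_dotProduct_mulVec_eq_largestEigenvalue
  rw [re_star_dotProduct_self] at hx
  have hxi : ∀ i, ‖x i‖ ≤ 1 := by
    intro i
    have h : ‖x i‖ ^ 2 ≤ ∑ i, ‖x i‖ ^ 2 :=
      Finset.single_le_sum (f := fun i => ‖x i‖ ^ 2) (fun i _ => by positivity) (Finset.mem_univ i)
    rw [hx] at h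
    exact (sq_le_one_iff₀ (norm_nonneg _)).1 h
  rw [← hl]
  refine (RCLike.re_le_norm _).trans ?_
  simp only [dotProduct, mulVec, Finset.mul_sum]
  refine (norm_sum_le _ _).trans (Finset.sum_le_sum fun i _ => ?_)
  refine (norm_sum_le _ _).trans (Finset.sum_le_sum fun j _ => ?_)
  rw [norm_mul, norm_mul, Pi.star_apply, norm_star]
  calc ‖x i‖ * (‖A i j‖ * ‖x j‖) ≤ 1 * (‖A i j‖ * 1) := by
        gcongr
        exacts [hxi i, hxi j]
    _ = ‖A i j‖ := by ring

theorem Matrix.IsHermitian.isLUB_range_re_dotProduct_mulVec (hA : A.IsHermitian)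
    {ι : Type*} {x : ι → {x : n → 𝕜 // re (star x ⬝ᵥ x) = 1}} (hx : DenseRange x) :
    IsLUB (Set.range fun k => re (star (x k).1 ⬝ᵥ A *ᵥ (x k).1)) (largestEigenvalue A) := by
  constructor
  · rintro _ ⟨k, rfl⟩
    have := hA.re_dotProduct_mulVec_le_largestEigenvalue (x k).1
    rwa [(x k).2, mul_one] at this
  · intro b hb
    obtain ⟨y, hy, hl⟩ := hA.exists_re_dotProduct_mulVec_eq_largestEigenvalue
    have hclosed : IsClosed {y : {x : n → 𝕜 // re (star x ⬝ᵥ x) = 1} |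
        re (star y.1 ⬝ᵥ A *ᵥ y.1) ≤ b} := by
      refine isClosed_le (RCLike.continuous_re.comp ?_) continuous_const
      fun_prop
    rw [← hl]
    exact hx.induction_on (p := fun y => re (star y.1 ⬝ᵥ A *ᵥ y.1) ≤ b) ⟨y, hy⟩ hclosed
      fun k => hb ⟨k, rfl⟩

/-- By continuity of the quadratic form, a dense sequence of unit vectors suffices, so the
eigenvalue is a countable supremum of linear combinations of the entries. -/
theorem aemeasurable_largestEigenvalue {Ω : Type*} [MeasurableSpace Ω] {P : Measure Ω}
    {H : Ω → Matrix n n 𝕜} (hH : ∀ ω, (H ω).IsHermitian)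
    (hmeas : ∀ i j, AEMeasurable (fun ω => H ω i j) P) :
    AEMeasurable (fun ω => largestEigenvalue (H ω)) P := by
  let S := {x : n → 𝕜 // re (star x ⬝ᵥ x) = 1}
  have : Nonempty S := by
    obtain ⟨x, hx, -⟩ :=
      (isHermitian_one (n := n) (α := 𝕜)).exists_re_dotProduct_mulVec_eq_largestEigenvalue
    exact ⟨⟨x, hx⟩⟩
  refine AEMeasurable.isLUB (f := fun k ω => re (star (TopologicalSpace.denseSeq S k).1 ⬝ᵥ
    H ω *ᵥ (TopologicalSpace.denseSeq S k).1)) (fun k => ?_) (ae_of_all _ fun ω =>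
      (hH ω).isLUB_range_re_dotProduct_mulVec (TopologicalSpace.denseRange_denseSeq S))
  simp only [dotProduct, mulVec]
  refine RCLike.measurable_re.comp_aemeasurable ?_
  fun_prop

end LargestEigenvalue

/-! ### Gaussian entries of the two ensembles. -/

section Ensembles

variable {Ω : Type*} [MeasurableSpace Ω] {P : Measure Ω} {N : ℕ} {v : ℝ≥0}

theorem IsGOE.isHermitian {H : Ω → Matrix (Fin N) (Fin N) ℝ} (hH : IsGOE H v P) (ω : Ω) :
    (H ω).IsHermitian := by
  rw [Matrix.IsHermitian, Matrix.conjTranspose_eq_transpose_of_trivial]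
  exact hH.isSymm ω

theorem IsGOE.exists_hasLaw {H : Ω → Matrix (Fin N) (Fin N) ℝ} (hH : IsGOE H v P) (i j : Fin N) :
    ∃ s, HasLaw (fun ω => H ω i j) (gaussianReal 0 s) P := by
  rcases lt_trichotomy i j with h | rfl | h
  · exact ⟨_, hH.law_offDiag i j h⟩
  · exact ⟨_, hH.law_diag i⟩
  · have := hH.law_offDiag j i h
    simp_rw [(hH.isSymm _).apply i j] at this
    exact ⟨_, this⟩

theorem IsGUE.exists_hasLaw_re {H : Ω → Matrix (Fin N) (Fin N) ℂ} (hH : IsGUE H v P)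
    (i j : Fin N) : ∃ s, HasLaw (fun ω => (H ω i j).re) (gaussianReal 0 s) P := by
  rcases lt_trichotomy i j with h | rfl | h
  · exact ⟨_, hH.law_offDiag_re i j h⟩
  · exact ⟨_, hH.law_diag i⟩
  · have := hH.law_offDiag_re j i h
    simp_rw [← fun ω => (hH.isHermitian ω).apply j i, Complex.star_def, Complex.conj_re] at this
    exact ⟨_, this⟩

theorem IsGUE.exists_hasLaw_im [IsProbabilityMeasure P] {H : Ω → Matrix (Fin N) (Fin N) ℂ}
    (hH : IsGUE H v P) (i j : Fin N) :
    ∃ s, HasLaw (fun ω => (H ω i j).im) (gaussianReal 0 s) P := by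
  rcases lt_trichotomy i j with h | rfl | h
  · exact ⟨_, hH.law_offDiag_im i j h⟩
  · have h0 : (fun ω => (H ω i i).im) = fun _ => (0 : ℝ) := by
      ext ω
      have := congrArg Complex.im ((hH.isHermitian ω).apply i i)
      simp only [Complex.star_def, Complex.conj_im] at this
      linarith
    -- The zero imaginary part on the diagonal counts as a Gaussian of variance `0`.
    refine ⟨0, ?_⟩
    rw [h0, gaussianReal_zero_var]
    exact ⟨aemeasurable_const, by simp⟩
  · have hneg : (fun ω => (H ω i j).im) = fun ω => -(H ω j i).im := by
      ext ω
      rw [← (hH.isHermitian ω).apply i j, Complex.star_def, Complex.conj_im]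
    refine ⟨v / 2, ?_⟩
    rw [hneg]
    simpa using! gaussianReal_neg (hH.law_offDiag_im j i h)

end Ensembles

theorem theorem2 (N : ℕ) (hN : 2 ≤ N) (v : ℝ≥0) (hv : 0 < v)
    {Ω : Type*} [MeasurableSpace Ω] (P : Measure Ω) [IsProbabilityMeasure P] :
    (∀ H : Ω → Matrix (Fin N) (Fin N) ℝ, IsGOE H v P →
      AEMeasurable (fun ω => largestEigenvalue (H ω)) P ∧
        ¬ IsInfinitelyDivisible (fun ω => largestEigenvalue (H ω)) P) ∧
    (∀ H : Ω → Matrix (Fin N) (Fin N) ℂ, IsGUE H v P →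
      AEMeasurable (fun ω => largestEigenvalue (H ω)) P ∧
        ¬ IsInfinitelyDivisible (fun ω => largestEigenvalue (H ω)) P) := by
  let i₀ : Fin N := ⟨0, by omega⟩
  let i₁ : Fin N := ⟨1, by omega⟩
  have hne : i₀ ≠ i₁ := by simp [i₀, i₁]
  have : Nonempty (Fin N) := ⟨i₀⟩
  constructor
  · intro H hH
    have hherm := hH.isHermitian
    choose s hs using hH.exists_hasLaw
    have hmeas : AEMeasurable (fun ω => largestEigenvalue (H ω)) P :=
      aemeasurable_largestEigenvalue hherm fun i j => (hs i j).aemeasurable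
    refine ⟨hmeas, ?_⟩
    have hindep : IndepFun (fun ω => H ω i₀ i₀) (fun ω => H ω i₁ i₁) P :=
      hH.indep.indepFun (i := ⟨(i₀, i₀), le_rfl⟩) (j := ⟨(i₁, i₁), le_rfl⟩) (by simpa using hne)
    refine not_isInfinitelyDivisible_of_gaussian_le (w := 2 * v) (by positivity) hmeas
      (hH.law_diag i₀) (hH.law_diag i₁) hindep
      (fun ω => (hherm ω).re_apply_self_le_largestEigenvalue i₀)
      (fun ω => (hherm ω).re_apply_self_le_largestEigenvalue i₁)
      (G := fun (p : Fin N × Fin N) ω => H ω p.1 p.2) (fun p => hs p.1 p.2) fun ω => ?_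
    rw [Fintype.sum_prod_type]
    exact (hherm ω).largestEigenvalue_le_sum_norm
  · intro H hH
    have hherm := hH.isHermitian
    choose s hs using hH.exists_hasLaw_re
    choose r hr using hH.exists_hasLaw_im
    have hmeas : AEMeasurable (fun ω => largestEigenvalue (H ω)) P :=
      aemeasurable_largestEigenvalue hherm fun i j =>
        aemeasurable_of_re_im (𝕜 := ℂ) (hs i j).aemeasurable (hr i j).aemeasurable
    refine ⟨hmeas, ?_⟩
    have hindep : IndepFun (fun ω => (H ω i₀ i₀).re) (fun ω => (H ω i₁ i₁).re) P := by
      simpa using hH.indep.indepFun (i := (i₀, i₀)) (j := (i₁, i₁)) (by simpa using hne)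
    refine not_isInfinitelyDivisible_of_gaussian_le hv hmeas
      (hH.law_diag i₀) (hH.law_diag i₁) hindep
      (fun ω => (hherm ω).re_apply_self_le_largestEigenvalue i₀)
      (fun ω => (hherm ω).re_apply_self_le_largestEigenvalue i₁)
      -- The modulus of a complex entry is not Gaussian, so the dominating family consists of real
      -- and imaginary parts.
      (G := Sum.elim (fun (p : Fin N × Fin N) ω => (H ω p.1 p.2).re)
        (fun (p : Fin N × Fin N) ω => (H ω p.1 p.2).im))
      (s := Sum.elim (fun p => s p.1 p.2) (fun p => r p.1 p.2)) ?_ fun ω => ?_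
    · rintro (p | p)
      exacts [hs p.1 p.2, hr p.1 p.2]
    · rw [Fintype.sum_sum_type, ← Finset.sum_add_distrib, Fintype.sum_prod_type]
      refine (hherm ω).largestEigenvalue_le_sum_norm.trans ?_
      gcongr with i _ j
      exact Complex.norm_le_abs_re_add_abs_im _
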